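/- Fix integers $n\ge 3$ and $2\le m\le k\le n$. A Plackett–Luce (PL) instance is a score vector $\theta=(\theta_1,\dots,\theta_n)$ with pairwise distinct entries in $(0,1]$ and $\max_i\theta_i=1$ (the order of the scores being unknown to the algorithm). A ranking is a permutation $\sigma$ of $[n]$, where $\sigma(i)$ is the position of item $i$ (the first position is the best). In every round a (possibly randomized) sequential algorithm, given all past observations, either plays a set $S\subseteq[n]$ of $k$ items or stops and outputs a ranking. After playing $S$ it receives top-$m$ ranking feedback: an ordered list $(r_1,\dots,r_m)$ of distinct items of $S$, drawn (conditionally independently of the past) with probability $\prod_{i=1}^{m}\theta_{r_i}\big/\sum_{j\in S\setminus\{r_1,\dots,r_{i-1}\}}\theta_j$. A ranking $\sigma$ is an $\epsilon$-best ranking for $\theta$ if there are no items $i,j$ with $\sigma(i)>\sigma(j)$ and $\theta_i\ge\theta_j+\epsilon$. An algorithm is $(\epsilon,\delta)$-PAC-Rank if, on every PL instance, it stops after finitely many rounds with probability $1$ and its output is an $\epsilon$-best ranking with probability at least $1-\delta$. It is symmetric if, for every PL instance $\theta$, every bijection $\varphi:[n]\to[n]$ and every ranking $\sigma$, the probability that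 it outputs $\sigma$ on $(\theta_1,\dots,\theta_n)$ equals the probability that it outputs $\sigma\circ\varphi$ on $(\theta_{\varphi(1)},\dots,\theta_{\varphi(n)})$. Its sample complexity on $\theta$ is the expected number of rounds it plays on $\theta$. **Theorem.** For every $\delta_0\in(0,1)$ there is a constant $c>0$, depending only on $\delta_0$, such that the following holds for all integers $n\ge 3$ with $n>1/(1-\delta_0)$ and $2\le m\le k\le n$, all $\epsilon\in(0,\tfrac18]$ and all $\delta\in(0,\delta_0]$: for every symmetric $(\epsilon,\delta)$-PAC-Rank algorithm with top-$m$ ranking feedback on $k$-subsets of $[n]$, there is a PL instance on which its sample complexity is at least $$c\,\frac{n}{m\epsilon^2}\,\ln\frac{n}{4\delta}.$$ (For instance, $\delta_0=\tfrac12$ gives a universal constant for all $n\ge3$ and all $\delta\le\tfrac12$.) -/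

import Mathlib

open scoped ENNReal

namespace PLRank

/-- Scores `θ` of a Plackett–Luce instance: positive, pairwise distinct, with largest score `1`.
No relation between the scores and the labels of the items is assumed. -/
structure IsInstance {n : ℕ} (θ : Fin n → ℝ) : Prop where
  pos : ∀ i, 0 < θ i
  le_one : ∀ i, θ i ≤ 1
  exists_eq_one : ∃ i, θ i = 1
  injective : Function.Injective θ

/-- A ranking of the items; `σ i` is the position of item `i` (position `0` is the best). -/
abbrev Ranking (n : ℕ) := Equiv.Perm (Fin n)

/-- The subsets of `k` items, which can be played in a round. -/
abbrev Play (n k : ℕ) := {S : Finset (Fin n) // S.card = k}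

/-- An ordered list of `m` distinct items. -/
abbrev Feedback (n m : ℕ) := Fin m ↪ Fin n

/-- Probability that top-`m` ranking feedback on the set `S` is the ordered list `r`:
`m` items of `S` are sampled successively without replacement, each with probability proportional
to its score among the items of `S` that have not been sampled yet. -/
noncomputable def feedbackProb {n m : ℕ} (θ : Fin n → ℝ) (S : Finset (Fin n))
    (r : Feedback n m) : ℝ :=
  if ∀ i, r i ∈ S then
    ∏ i : Fin m, θ (r i) / ∑ j ∈ S with ∀ l : Fin m, l < i → r l ≠ j, θ j
  else 0

/-- What the algorithm sees of the past: the played sets and the feedback received,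
the most recent round first. -/
abbrev History (n k m : ℕ) := List (Play n k × Feedback n m)

/-- A sequential randomized algorithm: given the history, it chooses at random (with a law of its
own choice) either a `k`-subset to play next, or to stop and output a ranking. -/
structure Algorithm (n k m : ℕ) where
  next : History n k m → PMF (Play n k ⊕ Ranking n)

namespace Algorithm

variable {n k m : ℕ}

/-- Probability, on the scores `θ`, that the algorithm plays at least as many rounds as the
history `h` has, and that its first rounds are exactly `h`. -/
noncomputable def runProb (A : Algorithm n k m) (θ : Fin n → ℝ) : History n k m → ℝ≥0∞
  | [] => 1
  | (S, r) :: h =>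
      A.runProb θ h * A.next h (Sum.inl S) * ENNReal.ofReal (feedbackProb θ S.1 r)

/-- Probability that the algorithm stops right after the history `h` and outputs `σ`. -/
noncomputable def stopProb (A : Algorithm n k m) (θ : Fin n → ℝ) (h : History n k m)
    (σ : Ranking n) : ℝ≥0∞ :=
  A.runProb θ h * A.next h (Sum.inr σ)

/-- Probability that the algorithm stops after finitely many rounds and outputs `σ`. -/
noncomputable def outputProb (A : Algorithm n k m) (θ : Fin n → ℝ) (σ : Ranking n) : ℝ≥0∞ :=
  ∑' h : History n k m, A.stopProb θ h σ

/-- Probability that the algorithm stops after finitely many rounds. -/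
noncomputable def haltProb (A : Algorithm n k m) (θ : Fin n → ℝ) : ℝ≥0∞ :=
  ∑ σ : Ranking n, A.outputProb θ σ

/-- Sample complexity: the expected number of rounds played (a run that never stops counts with
the value `∞`). -/
noncomputable def expectedRounds (A : Algorithm n k m) (θ : Fin n → ℝ) : ℝ≥0∞ :=
  (∑' h : History n k m, ∑ σ : Ranking n, (h.length : ℝ≥0∞) * A.stopProb θ h σ)
    + ⊤ * (1 - A.haltProb θ)

end Algorithm

/-- `σ` is an `ε`-best ranking: no item is ranked behind another one whose score is smaller by
at least `ε`. -/
def IsEpsBestRanking {n : ℕ} (θ : Fin n → ℝ) (ε : ℝ) (σ : Ranking n) : Prop :=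
  ¬ ∃ i j : Fin n, σ j < σ i ∧ θ j + ε ≤ θ i

open Classical in
/-- `(ε, δ)`-PAC-Rank: on every instance, the algorithm stops with probability one and its output
is an `ε`-best ranking with probability at least `1 - δ`. -/
def IsPACRank {n k m : ℕ} (A : Algorithm n k m) (ε δ : ℝ) : Prop :=
  ∀ θ : Fin n → ℝ, IsInstance θ →
    A.haltProb θ = 1 ∧
    ENNReal.ofReal (1 - δ) ≤ ∑ σ : Ranking n with IsEpsBestRanking θ ε σ, A.outputProb θ σ

/-- The algorithm does not depend on the labels of the items. In the relabelled instance `θ ∘ φ`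
item `i` plays the role of item `φ i`, so that its position in the corresponding ranking
is `σ (φ i)`. -/
def IsSymmetric {n k m : ℕ} (A : Algorithm n k m) : Prop :=
  ∀ θ : Fin n → ℝ, IsInstance θ → ∀ (φ : Equiv.Perm (Fin n)) (σ : Ranking n),
    A.outputProb θ σ = A.outputProb (θ ∘ φ) (φ.trans σ)

end PLRank

/-! The hard instance `twoGroups` has a better and a worse half, at least `ε` apart and all within
`2 * ε` of the top score. An `ε`-best ranking must put the better half first (`separating`).
Exchanging one better item with one worse item gives `N = q * (n - q)` alternatives, of order `n ^
2`. By symmetry, the probability of `separating` under an alternative is the probability, under the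
original scores, of separating the exchanged halves. These events are disjoint from each other and
from `separating` (`sum_separating_add_sum_swap_le`), so their probabilities sum to at most `δ`. An
average alternative thus has probability at most `δ / N` where the original has at least `1 - δ`;
this is the source of `ln (n / δ)` instead of `ln (1 / δ)`.

On the other side is information. A cross pair changes only two scores and an item lies in at most
`n` cross pairs, so the divergences of one round, summed over all alternatives, are at most `8 * n *
ε ^ 2 * m` whatever set is played (`sum_feedbackKL_le`, `sum_swap_chiSq_le`). A change of measure
(`expectedRounds_lower_bound`), with weights chosen in `exists_rate`, bounds `N * c * ln (n / (4 *
δ))` by this times the expected number of rounds. -/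

namespace PLRank

/-! ### Divergence of top-`m` feedback -/

section Feedback

variable {n m : ℕ}

/-- The feedback whose first item is `a` and which continues with `e`. -/
def consFeedback (a : Fin n) (e : Feedback n m) (h : a ∉ Set.range e) : Feedback n (m + 1) :=
  ⟨Fin.cons a e, Fin.cons_injective_iff.2 ⟨h, e.injective⟩⟩

@[simp] lemma consFeedback_zero (a : Fin n) (e : Feedback n m) (h : a ∉ Set.range e) :
    consFeedback a e h 0 = a := rfl

@[simp] lemma consFeedback_succ (a : Fin n) (e : Feedback n m) (h : a ∉ Set.range e)
    (i : Fin m) : consFeedback a e h i.succ = e i := rfl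

/-- Used to induct on the first draw. The sum on the right runs over all pairs, so `Φ` has to vanish
when the first item is repeated. -/
lemma sum_feedback_succ (F : Feedback n (m + 1) → ℝ) (Φ : Fin n → Feedback n m → ℝ)
    (h0 : ∀ (a : Fin n) (e : Feedback n m), a ∈ Set.range e → Φ a e = 0)
    (h1 : ∀ (a : Fin n) (e : Feedback n m) (h : a ∉ Set.range e), F (consFeedback a e h) = Φ a e) :
    ∑ r, F r = ∑ a, ∑ e, Φ a e := by
  classical
  rw [Finset.sum_comm, ← (Equiv.embeddingFinSucc m (Fin n)).symm.sum_comp, Fintype.sum_sigma]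
  refine Finset.sum_congr rfl fun e _ => ?_
  have h2 : ∀ a : {i // i ∉ Set.range e},
      F ((Equiv.embeddingFinSucc m (Fin n)).symm ⟨e, a⟩) = Φ a e := by
    intro a
    rw [← h1 a e a.2]
    congr 1
    ext i
    rw [Equiv.coe_embeddingFinSucc_symm]
    rfl
  simp_rw [h2]
  rw [← Finset.sum_subtype (Finset.univ.filter fun i => i ∉ Set.range e) (by simp)
    (fun a => Φ a e)]
  refine Finset.sum_subset (Finset.subset_univ _) fun a _ ha => h0 a e ?_
  by_contra h
  exact ha (by simpa using h)

lemma feedbackProb_nonneg {θ : Fin n → ℝ} (hθ : ∀ i, 0 < θ i) (S : Finset (Fin n))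
    (r : Feedback n m) : 0 ≤ feedbackProb θ S r := by
  unfold feedbackProb
  split_ifs
  · exact Finset.prod_nonneg fun i _ =>
      div_nonneg (hθ _).le (Finset.sum_nonneg fun j _ => (hθ j).le)
  · exact le_rfl

lemma feedbackProb_pos {θ : Fin n → ℝ} (hθ : ∀ i, 0 < θ i) {S : Finset (Fin n)}
    {r : Feedback n m} (hr : ∀ i, r i ∈ S) : 0 < feedbackProb θ S r := by
  rw [feedbackProb, if_pos hr]
  refine Finset.prod_pos fun i _ => div_pos (hθ _) (Finset.sum_pos (fun j _ => hθ j) ⟨r i, ?_⟩)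
  simp only [Finset.mem_filter]
  exact ⟨hr i, fun l hl h => hl.ne (r.injective h)⟩

lemma feedbackProb_eq_zero {θ : Fin n → ℝ} {S : Finset (Fin n)}
    {r : Feedback n m} (hr : ¬ ∀ i, r i ∈ S) : feedbackProb θ S r = 0 := if_neg hr

lemma feedbackProb_zero (θ : Fin n → ℝ) (S : Finset (Fin n)) (r : Feedback n 0) :
    feedbackProb θ S r = 1 := by
  rw [feedbackProb, if_pos (fun i => i.elim0)]; simp

lemma feedbackProb_erase_of_mem_range {θ : Fin n → ℝ} {S : Finset (Fin n)} {a : Fin n}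
    {e : Feedback n m} (h : a ∈ Set.range e) : feedbackProb θ (S.erase a) e = 0 := by
  obtain ⟨i, rfl⟩ := h
  exact feedbackProb_eq_zero fun h => by simpa using h i

lemma feedbackProb_consFeedback (θ : Fin n → ℝ) (S : Finset (Fin n)) (a : Fin n)
    (e : Feedback n m) (h : a ∉ Set.range e) :
    feedbackProb θ S (consFeedback a e h) =
      if a ∈ S then θ a / (∑ j ∈ S, θ j) * feedbackProb θ (S.erase a) e else 0 := by
  have hne : ∀ i, e i ≠ a := fun i hi => h ⟨i, hi⟩
  by_cases ha : a ∈ S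
  · rw [if_pos ha]
    by_cases he : ∀ i, e i ∈ S.erase a
    · have h1 : ∀ i, consFeedback a e h i ∈ S := by
        intro i
        cases i using Fin.cases with
        | zero => exact ha
        | succ i => exact Finset.mem_of_mem_erase (he i)
      rw [feedbackProb, if_pos h1, feedbackProb, if_pos he, Fin.prod_univ_succ]
      congr 1
      · simp
      · refine Finset.prod_congr rfl fun i _ => ?_
        rw [consFeedback_succ]
        congr 2
        ext j
        simp only [Finset.mem_filter, Fin.forall_fin_succ, Fin.succ_pos, Fin.succ_lt_succ_iff,
          consFeedback_zero, consFeedback_succ, Finset.mem_erase]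
        tauto
    · rw [feedbackProb_eq_zero he, mul_zero]
      refine feedbackProb_eq_zero fun h1 => he fun i => ?_
      exact Finset.mem_erase.2 ⟨hne i, h1 i.succ⟩
  · rw [if_neg ha]
    exact feedbackProb_eq_zero fun h1 => ha (h1 0)

lemma sum_feedbackProb {θ : Fin n → ℝ} (hθ : ∀ i, 0 < θ i) (m : ℕ) :
    ∀ S : Finset (Fin n), m ≤ S.card → ∑ r : Feedback n m, feedbackProb θ S r = 1 := by
  induction m with
  | zero =>
    intro S _
    simp [feedbackProb_zero]
  | succ m ih =>
    intro S hS
    rw [sum_feedback_succ _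
      (fun a e => if a ∈ S then θ a / (∑ j ∈ S, θ j) * feedbackProb θ (S.erase a) e else 0)
      (fun a e hae => by rw [feedbackProb_erase_of_mem_range hae]; simp)
      (fun a e h => feedbackProb_consFeedback θ S a e h)]
    have h1 : ∀ a, ∑ e : Feedback n m,
        (if a ∈ S then θ a / (∑ j ∈ S, θ j) * feedbackProb θ (S.erase a) e else 0) =
        if a ∈ S then θ a / (∑ j ∈ S, θ j) else 0 := by
      intro a
      split_ifs with ha
      · rw [← Finset.mul_sum, ih _ (by rw [Finset.card_erase_of_mem ha]; omega), mul_one]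
      · simp
    simp_rw [h1]
    rw [Finset.sum_ite_mem, Finset.univ_inter, ← Finset.sum_div, div_self]
    exact (Finset.sum_pos (fun j _ => hθ j) (Finset.card_pos.1 (by omega))).ne'

/-- Kullback–Leibler divergence between the feedback laws of two score vectors on the set `S`. -/
noncomputable def feedbackKL (m : ℕ) (θ θ' : Fin n → ℝ) (S : Finset (Fin n)) : ℝ :=
  ∑ r : Feedback n m,
    feedbackProb θ S r * (Real.log (feedbackProb θ S r) - Real.log (feedbackProb θ' S r))

/-- Chain rule: after the first draw `a`, the rest is top-`m` feedback on `S.erase a`. -/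
lemma feedbackKL_succ {θ θ' : Fin n → ℝ} (hθ : ∀ i, 0 < θ i) (hθ' : ∀ i, 0 < θ' i)
    {S : Finset (Fin n)} (hS : m + 1 ≤ S.card) :
    feedbackKL (m + 1) θ θ' S = ∑ a ∈ S, θ a / (∑ j ∈ S, θ j) *
      (Real.log (θ a / ∑ j ∈ S, θ j) - Real.log (θ' a / ∑ j ∈ S, θ' j) +
        feedbackKL m θ θ' (S.erase a)) := by
  have hne : S.Nonempty := Finset.card_pos.1 (by omega)
  have hW := Finset.sum_pos (fun j _ => hθ j) hne
  have hW' := Finset.sum_pos (fun j _ => hθ' j) hne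
  rw [feedbackKL, sum_feedback_succ _
    (fun a e => if a ∈ S then θ a / (∑ j ∈ S, θ j) * (feedbackProb θ (S.erase a) e *
      (Real.log (θ a / ∑ j ∈ S, θ j) - Real.log (θ' a / ∑ j ∈ S, θ' j)) +
      feedbackProb θ (S.erase a) e * (Real.log (feedbackProb θ (S.erase a) e) -
        Real.log (feedbackProb θ' (S.erase a) e))) else 0)]
  · refine (Finset.sum_subset (Finset.subset_univ S) fun a _ ha => by simp [ha]).symm.trans
      (Finset.sum_congr rfl fun a ha => ?_)
    simp_rw [if_pos ha]
    rw [← Finset.mul_sum, Finset.sum_add_distrib, ← Finset.sum_mul,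
      sum_feedbackProb hθ m _ (by rw [Finset.card_erase_of_mem ha]; omega), one_mul]
    rfl
  · intro a e hae
    simp [feedbackProb_erase_of_mem_range hae]
  · intro a e h
    rw [feedbackProb_consFeedback, feedbackProb_consFeedback]
    split_ifs with ha
    · by_cases he : ∀ i, e i ∈ S.erase a
      · rw [Real.log_mul (div_pos (hθ a) hW).ne' (feedbackProb_pos hθ he).ne',
          Real.log_mul (div_pos (hθ' a) hW').ne' (feedbackProb_pos hθ' he).ne']
        ring
      · simp [feedbackProb_eq_zero he]
    · simp

/-- Apply `log t ≤ t - 1` separately to the ratio of the scores and to that of the normalizations.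
The normalization terms cancel after averaging, which leaves a chi-square distance of the
unnormalized scores, additive over the items. -/
lemma sum_log_ratio_le {θ θ' : Fin n → ℝ} (hθ : ∀ i, 0 < θ i) (hθ' : ∀ i, 0 < θ' i)
    {S : Finset (Fin n)} (hS : S.Nonempty) :
    ∑ a ∈ S, θ a / (∑ j ∈ S, θ j) *
      (Real.log (θ a / ∑ j ∈ S, θ j) - Real.log (θ' a / ∑ j ∈ S, θ' j)) ≤
    (∑ a ∈ S, (θ a - θ' a) ^ 2 / θ' a) / ∑ j ∈ S, θ j := by
  have hW := Finset.sum_pos (fun j _ => hθ j) hS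
  have hW' := Finset.sum_pos (fun j _ => hθ' j) hS
  set W := ∑ j ∈ S, θ j with hWdef
  set W' := ∑ j ∈ S, θ' j with hWdef'
  have h1 : ∀ a ∈ S, θ a / W * (Real.log (θ a / W) - Real.log (θ' a / W')) ≤
      θ a / W * ((θ a / θ' a - 1) + (W' / W - 1)) := by
    intro a _
    refine mul_le_mul_of_nonneg_left ?_ (div_pos (hθ a) hW).le
    rw [Real.log_div (hθ a).ne' hW.ne', Real.log_div (hθ' a).ne' hW'.ne']
    have h2 := Real.log_le_sub_one_of_pos (div_pos (hθ a) (hθ' a))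
    have h3 := Real.log_le_sub_one_of_pos (div_pos hW' hW)
    rw [Real.log_div (hθ a).ne' (hθ' a).ne'] at h2
    rw [Real.log_div hW'.ne' hW.ne'] at h3
    linarith
  refine (Finset.sum_le_sum h1).trans (le_of_eq ?_)
  have h4 : ∀ a ∈ S, θ a / W * ((θ a / θ' a - 1) + (W' / W - 1)) =
      ((θ a - θ' a) ^ 2 / θ' a) / W + (θ a / W * (W' / W) - θ' a / W) := by
    intro a _
    have := (hθ' a).ne'
    field_simp
    ring
  rw [Finset.sum_congr rfl h4, Finset.sum_add_distrib, Finset.sum_sub_distrib, ← Finset.sum_mul,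
    ← Finset.sum_div, ← Finset.sum_div, ← Finset.sum_div, ← hWdef, ← hWdef', div_self hW.ne']
  ring

/-- Additivity over items lets the sum over `P` be taken item by item: `hB` then gives `B` times the
total score of `S`, and dividing by that score leaves `B` per draw, for every `S`. -/
lemma sum_feedbackKL_le {ι : Type*} (P : Finset ι) {θ : Fin n → ℝ} {θ' : ι → Fin n → ℝ}
    (hθ : ∀ i, 0 < θ i) (hθ' : ∀ p i, 0 < θ' p i) {B : ℝ}
    (hB : ∀ a, ∑ p ∈ P, (θ a - θ' p a) ^ 2 / θ' p a ≤ B * θ a) (m : ℕ) :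
    ∀ S : Finset (Fin n), m ≤ S.card → ∑ p ∈ P, feedbackKL m θ (θ' p) S ≤ B * m := by
  induction m with
  | zero =>
    intro S _
    simp [feedbackKL, feedbackProb_zero]
  | succ m ih =>
    intro S hS
    have hne : S.Nonempty := Finset.card_pos.1 (by omega)
    have hW := Finset.sum_pos (fun j _ => hθ j) hne
    simp_rw [fun p => feedbackKL_succ (m := m) hθ (hθ' p) hS, mul_add, Finset.sum_add_distrib]
    have h1 : ∑ p ∈ P, ∑ a ∈ S, θ a / (∑ j ∈ S, θ j) *
        (Real.log (θ a / ∑ j ∈ S, θ j) - Real.log (θ' p a / ∑ j ∈ S, θ' p j)) ≤ B := by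
      refine (Finset.sum_le_sum fun p _ => sum_log_ratio_le hθ (hθ' p) hne).trans ?_
      rw [← Finset.sum_div, Finset.sum_comm, div_le_iff₀ hW, Finset.mul_sum]
      exact Finset.sum_le_sum fun a _ => hB a
    have h2 : ∑ p ∈ P, ∑ a ∈ S, θ a / (∑ j ∈ S, θ j) * feedbackKL m θ (θ' p) (S.erase a) ≤
        B * m := by
      rw [Finset.sum_comm]
      simp_rw [← Finset.mul_sum]
      calc _ ≤ ∑ a ∈ S, θ a / (∑ j ∈ S, θ j) * (B * m) :=
            Finset.sum_le_sum fun a ha => mul_le_mul_of_nonneg_left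
              (ih _ (by rw [Finset.card_erase_of_mem ha]; omega)) (div_pos (hθ a) hW).le
        _ = B * m := by rw [← Finset.sum_mul, ← Finset.sum_div, div_self hW.ne', one_mul]
    push_cast
    simp only [mul_sub] at h1 ⊢
    linarith

end Feedback

end PLRank

namespace PLRank

/-! ### Runs by number of rounds, and change of measure -/

section Levels

lemma sum_vector_succ {α M : Type*} [Fintype α] [AddCommMonoid M] (d : ℕ) (F : List α → M) :
    ∑ v : List.Vector α (d + 1), F v.1 = ∑ v : List.Vector α d, ∑ a, F (a :: v.1) := by
  rw [← Fintype.sum_prod_type' (f := fun (v : List.Vector α d) a => F (a :: v.1))]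
  refine Fintype.sum_equiv
    { toFun := fun v => (v.tail, v.head)
      invFun := fun p => p.2 ::ᵥ p.1
      left_inv := fun v => by simp
      right_inv := fun p => by simp } _ _ fun v => ?_
  obtain ⟨l, hl⟩ := v
  cases l with
  | nil => simp at hl
  | cons a l => rfl

lemma sum_vector_zero {α M : Type*} [Fintype α] [AddCommMonoid M] (F : List α → M) :
    ∑ v : List.Vector α 0, F v.1 = F [] := by
  rw [Fintype.sum_eq_single List.Vector.nil fun v hv => (hv (Subsingleton.elim _ _)).elim]
  rfl

lemma tsum_list_eq {α : Type*} [Fintype α] (F : List α → ℝ≥0∞) :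
    ∑' h, F h = ∑' d, ∑ v : List.Vector α d, F v.1 := by
  rw [← (Equiv.sigmaFiberEquiv (List.length (α := α))).tsum_eq, ENNReal.tsum_sigma']
  refine tsum_congr fun d => ?_
  exact tsum_fintype (L := .unconditional _) (fun v : List.Vector α d => F v.1)

end Levels

namespace Algorithm

variable {n k m : ℕ} (A : Algorithm n k m) (θ : Fin n → ℝ)

lemma sum_next (h : History n k m) :
    ∑ S, (A.next h (Sum.inl S)) + ∑ σ, (A.next h (Sum.inr σ)) = 1 := by
  rw [← Fintype.sum_sum_type, ← tsum_fintype (L := .unconditional _)]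
  exact (A.next h).tsum_coe

lemma sum_next_toReal (h : History n k m) :
    ∑ S, (A.next h (Sum.inl S)).toReal + ∑ σ, (A.next h (Sum.inr σ)).toReal = 1 := by
  rw [← ENNReal.toReal_sum fun _ _ => PMF.apply_ne_top _ _,
    ← ENNReal.toReal_sum fun _ _ => PMF.apply_ne_top _ _, ← ENNReal.toReal_add, sum_next]
  · rfl
  · exact ENNReal.sum_ne_top.2 fun _ _ => PMF.apply_ne_top _ _
  · exact ENNReal.sum_ne_top.2 fun _ _ => PMF.apply_ne_top _ _

lemma runProb_ne_top (h : History n k m) : A.runProb θ h ≠ ⊤ := by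
  induction h with
  | nil => simp [runProb]
  | cons p h ih =>
    exact ENNReal.mul_ne_top (ENNReal.mul_ne_top ih (PMF.apply_ne_top _ _)) ENNReal.ofReal_ne_top

/-- Expected value of `F` over the histories of the runs that play at least `d` rounds. -/
noncomputable def runSum (d : ℕ) (F : History n k m → ℝ) : ℝ :=
  ∑ v : List.Vector (Play n k × Feedback n m) d, (A.runProb θ v.1).toReal * F v.1

/-- Expected value of `F` over the runs that stop right after `d` rounds and output a ranking
in `E`. -/
noncomputable def stopSum (E : Finset (Ranking n)) (d : ℕ) (F : History n k m → ℝ) : ℝ :=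
  A.runSum θ d fun h => ∑ σ ∈ E, (A.next h (Sum.inr σ)).toReal * F h

lemma runSum_mono {d : ℕ} {F G : History n k m → ℝ} (h : ∀ x, F x ≤ G x) :
    A.runSum θ d F ≤ A.runSum θ d G :=
  Finset.sum_le_sum fun _ _ => mul_le_mul_of_nonneg_left (h _) ENNReal.toReal_nonneg

lemma runSum_add (d : ℕ) (F G : History n k m → ℝ) :
    A.runSum θ d (fun x => F x + G x) = A.runSum θ d F + A.runSum θ d G := by
  simp [runSum, mul_add, Finset.sum_add_distrib]

lemma runSum_mul_const (d : ℕ) (F : History n k m → ℝ) (c : ℝ) :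
    A.runSum θ d (fun x => F x * c) = A.runSum θ d F * c := by
  simp [runSum, Finset.sum_mul, mul_assoc]

lemma runSum_finset_sum {ι : Type*} (P : Finset ι) (d : ℕ) (F : ι → History n k m → ℝ) :
    A.runSum θ d (fun x => ∑ p ∈ P, F p x) = ∑ p ∈ P, A.runSum θ d (F p) := by
  simp only [runSum, Finset.mul_sum]
  rw [Finset.sum_comm]

lemma runSum_zero (F : History n k m → ℝ) : A.runSum θ 0 F = F [] := by
  rw [runSum, sum_vector_zero (fun h => (A.runProb θ h).toReal * F h)]
  simp [runProb]

variable {θ}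

lemma runSum_succ (hθ : ∀ i, 0 < θ i) (d : ℕ) (F : History n k m → ℝ) :
    A.runSum θ (d + 1) F = A.runSum θ d fun h => ∑ S, (A.next h (Sum.inl S)).toReal *
      ∑ r, feedbackProb θ S.1 r * F ((S, r) :: h) := by
  rw [runSum, sum_vector_succ d (fun h => (A.runProb θ h).toReal * F h), runSum]
  refine Finset.sum_congr rfl fun v _ => ?_
  rw [Fintype.sum_prod_type, Finset.mul_sum]
  refine Finset.sum_congr rfl fun S _ => ?_
  rw [Finset.mul_sum, Finset.mul_sum]
  refine Finset.sum_congr rfl fun r _ => ?_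
  simp only [runProb, ENNReal.toReal_mul, ENNReal.toReal_ofReal (feedbackProb_nonneg hθ S.1 r)]
  ring

/-- Splitting the runs that reach a history into those that stop there and those that go on. -/
lemma runSum_split (hθ : ∀ i, 0 < θ i) (hmk : m ≤ k) (d : ℕ) (F : History n k m → ℝ)
    (g : Play n k → Feedback n m → ℝ) (G : History n k m → ℝ)
    (hG : ∀ S r h, G ((S, r) :: h) = G h + g S r) (hF : F = G) :
    A.runSum θ d F + A.runSum θ d (fun h => ∑ S, (A.next h (Sum.inl S)).toReal *
        ∑ r, feedbackProb θ S.1 r * g S r) =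
      A.stopSum θ Finset.univ d F + A.runSum θ (d + 1) F := by
  subst hF
  rw [runSum_succ A hθ, stopSum, ← runSum_add, ← runSum_add]
  congr 1
  funext h
  have h1 : ∀ S : Play n k, ∑ r : Feedback n m, feedbackProb θ S.1 r * F ((S, r) :: h) =
      F h + ∑ r, feedbackProb θ S.1 r * g S r := by
    intro S
    simp_rw [hG, mul_add, Finset.sum_add_distrib, ← Finset.sum_mul]
    rw [sum_feedbackProb hθ m _ (by rw [S.2]; exact hmk), one_mul]
  simp_rw [h1, mul_add, Finset.sum_add_distrib, ← Finset.sum_mul]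
  have := A.sum_next_toReal h
  linear_combination (-F h) * this

lemma mass_step (hθ : ∀ i, 0 < θ i) (hmk : m ≤ k) (d : ℕ) :
    A.runSum θ d (fun _ => 1) =
      A.stopSum θ Finset.univ d (fun _ => 1) + A.runSum θ (d + 1) (fun _ => 1) := by
  have := A.runSum_split hθ hmk d (fun _ => 1) (fun _ _ => 0) (fun _ => 1) (by simp) rfl
  simpa [runSum] using this

lemma mass_eq_one (hθ : ∀ i, 0 < θ i) (hmk : m ≤ k) (D : ℕ) :
    ∑ d ∈ Finset.range D, A.stopSum θ Finset.univ d (fun _ => 1) +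
      A.runSum θ D (fun _ => 1) = 1 := by
  induction D with
  | zero => simp [runSum_zero]
  | succ D ih =>
    rw [Finset.sum_range_succ, add_assoc, ← mass_step A hθ hmk, ih]

/-- Log-likelihood ratio of a history. -/
noncomputable def logRatio (θ θ' : Fin n → ℝ) : History n k m → ℝ
  | [] => 0
  | (S, r) :: h => logRatio θ θ' h +
      (Real.log (feedbackProb θ S.1 r) - Real.log (feedbackProb θ' S.1 r))

variable {θ' : Fin n → ℝ}

lemma runProb_eq_mul_exp (hθ : ∀ i, 0 < θ i) (hθ' : ∀ i, 0 < θ' i) (h : History n k m) :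
    (A.runProb θ' h).toReal = (A.runProb θ h).toReal * Real.exp (-logRatio θ θ' h) := by
  induction h with
  | nil => simp [runProb, logRatio]
  | cons p h ih =>
    obtain ⟨S, r⟩ := p
    simp only [runProb, ENNReal.toReal_mul, logRatio, ih,
      ENNReal.toReal_ofReal (feedbackProb_nonneg hθ S.1 r),
      ENNReal.toReal_ofReal (feedbackProb_nonneg hθ' S.1 r)]
    by_cases hr : ∀ i, r i ∈ S.1
    · have h1 := feedbackProb_pos hθ hr
      have h2 := feedbackProb_pos hθ' hr
      rw [neg_add, Real.exp_add, neg_sub, Real.exp_sub, Real.exp_log h1, Real.exp_log h2]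
      field_simp
    · simp [feedbackProb_eq_zero hr]

/-- Chain rule for the divergence of the first `D` rounds. -/
lemma sum_stopSum_logRatio (hθ : ∀ i, 0 < θ i) (hmk : m ≤ k) (θ' : Fin n → ℝ) (D : ℕ) :
    ∑ d ∈ Finset.range D, A.stopSum θ Finset.univ d (logRatio θ θ') +
      A.runSum θ D (logRatio θ θ') =
    ∑ d ∈ Finset.range D, A.runSum θ d (fun h => ∑ S, (A.next h (Sum.inl S)).toReal *
      feedbackKL m θ θ' S.1) := by
  induction D with
  | zero => simp [runSum_zero, logRatio]
  | succ D ih =>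
    have := A.runSum_split hθ hmk D (logRatio θ θ') (fun S r =>
      Real.log (feedbackProb θ S.1 r) - Real.log (feedbackProb θ' S.1 r)) _
      (fun S r h => rfl) rfl
    rw [Finset.sum_range_succ, Finset.sum_range_succ, ← ih]
    simp only [feedbackKL]
    linarith

/-- Tangent inequality, sharp at `l = log c`. It is linear in the likelihood ratio `exp (-l)`, hence
in the probabilities under the alternative. -/
lemma mul_log_add_sub_le {c : ℝ} (hc : 0 < c) (l : ℝ) :
    Real.log c + 1 - c * Real.exp (-l) ≤ l := by
  have := Real.add_one_le_exp (Real.log c - l)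
  rw [sub_eq_add_neg, Real.exp_add, Real.exp_log hc] at this
  linarith

lemma runSum_const_le (hθ : ∀ i, 0 < θ i) (hθ' : ∀ i, 0 < θ' i) {c : ℝ} (hc : 0 < c)
    (d : ℕ) (w : History n k m → ℝ) (hw : ∀ h, 0 ≤ w h) :
    A.runSum θ d w * (Real.log c + 1) - c * A.runSum θ' d w ≤
      A.runSum θ d (fun h => w h * logRatio θ θ' h) := by
  simp only [runSum, Finset.sum_mul, Finset.mul_sum, ← Finset.sum_sub_distrib]
  refine Finset.sum_le_sum fun v _ => ?_
  rw [A.runProb_eq_mul_exp hθ hθ']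
  have h1 := mul_le_mul_of_nonneg_left (mul_log_add_sub_le hc (logRatio θ θ' v.1))
    (mul_nonneg (ENNReal.toReal_nonneg (a := A.runProb θ v.1)) (hw v.1))
  linarith

/-- Probability of stopping within fewer than `D` rounds with an output in `E`. -/
noncomputable def earlyProb (θ : Fin n → ℝ) (E : Finset (Ranking n)) (D : ℕ) : ℝ :=
  ∑ d ∈ Finset.range D, A.stopSum θ E d (fun _ => 1)

/-- The tangent inequality is used with `c₁` on runs stopping before `D` in `E`, and with `c₀` on
all others, including those still running. Optimal weights would give the binary relative entropy;
free ones can be shared by all alternatives. -/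
lemma change_of_measure (hθ : ∀ i, 0 < θ i) (hθ' : ∀ i, 0 < θ' i) (hmk : m ≤ k)
    (E : Finset (Ranking n)) (D : ℕ) {c₀ c₁ : ℝ} (hc₀ : 0 < c₀) (hc₁ : 0 < c₁) :
    A.earlyProb θ E D * Real.log c₁ + (1 - A.earlyProb θ E D) * Real.log c₀ + 1
        - c₁ * A.earlyProb θ' E D - c₀ * (1 - A.earlyProb θ' E D) ≤
      ∑ d ∈ Finset.range D, A.runSum θ d (fun h => ∑ S, (A.next h (Sum.inl S)).toReal *
        feedbackKL m θ θ' S.1) := by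
  classical
  rw [← A.sum_stopSum_logRatio hθ hmk]
  have hsplit : ∀ (η : Fin n → ℝ) (d : ℕ) (F : History n k m → ℝ),
      A.stopSum η Finset.univ d F = A.stopSum η E d F + A.stopSum η Eᶜ d F := by
    intro η d F
    simp only [stopSum, ← runSum_add, Finset.sum_add_sum_compl]
  have hcompl : ∀ (η : Fin n → ℝ), (∀ i, 0 < η i) → 1 - A.earlyProb η E D =
      ∑ d ∈ Finset.range D, A.stopSum η Eᶜ d (fun _ => 1) + A.runSum η D (fun _ => 1) := by
    intro η hη
    have := A.mass_eq_one hη hmk D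
    simp_rw [hsplit, Finset.sum_add_distrib] at this
    rw [earlyProb]
    linarith
  have hleaf : ∀ (E : Finset (Ranking n)) {c : ℝ}, 0 < c → ∀ d,
      A.stopSum θ E d (fun _ => 1) * (Real.log c + 1) - c * A.stopSum θ' E d (fun _ => 1) ≤
        A.stopSum θ E d (logRatio θ θ') := by
    intro E c hc d
    simp only [stopSum, mul_one, ← Finset.sum_mul]
    exact A.runSum_const_le hθ hθ' hc d _ fun h =>
      Finset.sum_nonneg fun σ _ => ENNReal.toReal_nonneg
  have h1 := Finset.sum_le_sum fun d (_ : d ∈ Finset.range D) => hleaf E hc₁ d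
  have h2 := Finset.sum_le_sum fun d (_ : d ∈ Finset.range D) => hleaf Eᶜ hc₀ d
  have h3 := A.runSum_const_le hθ hθ' hc₀ D (fun _ => 1) fun _ => zero_le_one
  simp_rw [one_mul] at h3
  rw [Finset.sum_sub_distrib, ← Finset.sum_mul, ← Finset.mul_sum] at h1 h2
  simp_rw [hsplit, Finset.sum_add_distrib]
  rw [hcompl θ hθ, hcompl θ' hθ']
  have h4 := hcompl θ hθ
  unfold earlyProb at h4 ⊢
  linarith

end Algorithm

end PLRank

namespace PLRank

/-! ### Stopping times and the information bound -/

namespace Algorithm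

variable {n k m : ℕ} (A : Algorithm n k m) {θ : Fin n → ℝ}

lemma runSum_nonneg (θ : Fin n → ℝ) (d : ℕ) {F : History n k m → ℝ} (hF : ∀ h, 0 ≤ F h) :
    0 ≤ A.runSum θ d F :=
  Finset.sum_nonneg fun _ _ => mul_nonneg ENNReal.toReal_nonneg (hF _)

lemma stopSum_one_nonneg (θ : Fin n → ℝ) (E : Finset (Ranking n)) (d : ℕ) :
    0 ≤ A.stopSum θ E d (fun _ => 1) :=
  A.runSum_nonneg θ d fun _ => Finset.sum_nonneg fun _ _ => by simp

lemma ofReal_stopSum_one (θ : Fin n → ℝ) (E : Finset (Ranking n)) (d : ℕ) :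
    ENNReal.ofReal (A.stopSum θ E d (fun _ => 1)) =
      ∑ v : List.Vector (Play n k × Feedback n m) d, ∑ σ ∈ E, A.stopProb θ v.1 σ := by
  have hfin : ∀ (h : History n k m) (σ : Ranking n), A.stopProb θ h σ ≠ ⊤ := fun h σ =>
    ENNReal.mul_ne_top (A.runProb_ne_top θ h) (PMF.apply_ne_top _ _)
  rw [← ENNReal.ofReal_toReal (a := ∑ v : List.Vector (Play n k × Feedback n m) d, _)
    (ENNReal.sum_ne_top.2 fun v _ => ENNReal.sum_ne_top.2 fun σ _ => hfin v.1 σ)]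
  congr 1
  rw [ENNReal.toReal_sum fun v _ => ENNReal.sum_ne_top.2 fun σ _ => hfin v.1 σ, stopSum, runSum]
  refine Finset.sum_congr rfl fun v _ => ?_
  rw [ENNReal.toReal_sum fun σ _ => hfin v.1 σ, Finset.mul_sum]
  simp [stopProb]

lemma sum_outputProb (θ : Fin n → ℝ) (E : Finset (Ranking n)) :
    ∑ σ ∈ E, A.outputProb θ σ = ∑' d, ENNReal.ofReal (A.stopSum θ E d (fun _ => 1)) := by
  simp_rw [ofReal_stopSum_one]
  rw [← tsum_list_eq (fun h : History n k m => ∑ σ ∈ E, A.stopProb θ h σ)]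
  simp only [outputProb]
  exact (Summable.tsum_finsetSum fun _ _ => ENNReal.summable).symm

lemma ofReal_earlyProb (θ : Fin n → ℝ) (E : Finset (Ranking n)) (D : ℕ) :
    ENNReal.ofReal (A.earlyProb θ E D) =
      ∑ d ∈ Finset.range D, ENNReal.ofReal (A.stopSum θ E d (fun _ => 1)) :=
  ENNReal.ofReal_sum_of_nonneg fun d _ => A.stopSum_one_nonneg θ E d

lemma earlyProb_nonneg (θ : Fin n → ℝ) (E : Finset (Ranking n)) (D : ℕ) :
    0 ≤ A.earlyProb θ E D :=
  Finset.sum_nonneg fun d _ => A.stopSum_one_nonneg θ E d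

lemma tendsto_earlyProb (E : Finset (Ranking n)) (h : ∑ σ ∈ E, A.outputProb θ σ ≠ ⊤) :
    Filter.Tendsto (A.earlyProb θ E) Filter.atTop (nhds (∑ σ ∈ E, A.outputProb θ σ).toReal) := by
  have h1 := ENNReal.tendsto_nat_tsum fun d => ENNReal.ofReal (A.stopSum θ E d (fun _ => 1))
  rw [← sum_outputProb] at h1
  simp_rw [← ofReal_earlyProb] at h1
  refine ((ENNReal.tendsto_toReal h).comp h1).congr fun D => ?_
  exact ENNReal.toReal_ofReal (A.earlyProb_nonneg θ E D)

lemma earlyProb_le (E : Finset (Ranking n)) {y : ℝ} (hy : 0 ≤ y)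
    (h : ∑ σ ∈ E, A.outputProb θ σ ≤ ENNReal.ofReal y) (D : ℕ) : A.earlyProb θ E D ≤ y := by
  rw [← ENNReal.ofReal_le_ofReal_iff hy, ofReal_earlyProb]
  exact (ENNReal.sum_le_tsum _).trans ((A.sum_outputProb θ E).symm.trans_le h)

lemma expectedRounds_eq (h : A.haltProb θ = 1) : A.expectedRounds θ =
    ∑' d : ℕ, (d : ℝ≥0∞) * ENNReal.ofReal (A.stopSum θ Finset.univ d (fun _ => 1)) := by
  rw [expectedRounds, h, tsub_self, mul_zero, add_zero,
    tsum_list_eq fun h : History n k m => ∑ σ, (h.length : ℝ≥0∞) * A.stopProb θ h σ]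
  refine tsum_congr fun d => ?_
  rw [ofReal_stopSum_one, Finset.mul_sum]
  refine Finset.sum_congr rfl fun v _ => ?_
  rw [Finset.mul_sum, v.2]

lemma sum_stopSum_le_expectedRounds (h : A.haltProb θ = 1) (ht : A.expectedRounds θ ≠ ⊤) (D : ℕ) :
    ∑ d ∈ Finset.range D, (d : ℝ) * A.stopSum θ Finset.univ d (fun _ => 1) ≤
      (A.expectedRounds θ).toReal := by
  rw [← ENNReal.ofReal_le_iff_le_toReal ht, A.expectedRounds_eq h, ENNReal.ofReal_sum_of_nonneg
    fun d _ => mul_nonneg d.cast_nonneg (A.stopSum_one_nonneg θ _ d)]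
  simp_rw [ENNReal.ofReal_mul (Nat.cast_nonneg _), ENNReal.ofReal_natCast]
  exact ENNReal.sum_le_tsum _

/-- Summation by parts: the expectation of the number of rounds truncated at `D`. -/
lemma sum_runSum_one_eq (hθ : ∀ i, 0 < θ i) (hmk : m ≤ k) (D : ℕ) :
    ∑ d ∈ Finset.range D, A.runSum θ (d + 1) (fun _ => 1) =
      ∑ d ∈ Finset.range D, (d : ℝ) * A.stopSum θ Finset.univ d (fun _ => 1) +
        D * A.runSum θ D (fun _ => 1) := by
  induction D with
  | zero => simp
  | succ D ih =>
    rw [Finset.sum_range_succ, Finset.sum_range_succ, ih, A.mass_step hθ hmk D]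
    push_cast
    ring

lemma sum_runSum_one_le (hθ : ∀ i, 0 < θ i) (hmk : m ≤ k) (h : A.haltProb θ = 1)
    (ht : A.expectedRounds θ ≠ ⊤) (D : ℕ) :
    ∑ d ∈ Finset.range D, A.runSum θ (d + 1) (fun _ => 1) ≤ (A.expectedRounds θ).toReal := by
  rw [A.sum_runSum_one_eq hθ hmk]
  have h1 : A.runSum θ D (fun _ => 1) = 1 - A.earlyProb θ Finset.univ D := by
    have := A.mass_eq_one hθ hmk D
    rw [earlyProb]; linarith
  have h2 := A.tendsto_earlyProb (θ := θ) Finset.univ (by rw [← haltProb, h]; simp)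
  rw [← haltProb, h, ENNReal.toReal_one] at h2
  rw [h1]
  have h3 := ((h2.sub_const (A.earlyProb θ Finset.univ D)).const_mul (D : ℝ)).const_add
    (∑ d ∈ Finset.range D, (d : ℝ) * A.stopSum θ Finset.univ d (fun _ => 1))
  -- For `D ≤ D'`, `D` times the probability of stopping in `[D, D')` is at most the contribution of
  -- these runs to the expectation. Almost sure halting lets `D'` tend to infinity.
  refine le_of_tendsto h3 (Filter.eventually_atTop.2 ⟨D, fun D' hD => ?_⟩)
  refine le_trans ?_ (A.sum_stopSum_le_expectedRounds h ht D')
  rw [earlyProb, earlyProb, ← Finset.sum_Ico_eq_sub _ hD, ← Finset.sum_range_add_sum_Ico _ hD,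
    Finset.mul_sum]
  gcongr with d hd
  · exact A.stopSum_one_nonneg θ _ d
  · exact (Finset.mem_Ico.1 hd).1

/-- Change of measure from one score vector to a family of alternatives. -/
lemma expectedRounds_lower_bound (hθ : ∀ i, 0 < θ i) (hmk : m ≤ k) (h : A.haltProb θ = 1)
    (ht : A.expectedRounds θ ≠ ⊤) {ι : Type*} (P : Finset ι) {θ' : ι → Fin n → ℝ}
    (hθ' : ∀ p i, 0 < θ' p i) {B : ℝ} (hB0 : 0 ≤ B)
    (hB : ∀ a, ∑ p ∈ P, (θ a - θ' p a) ^ 2 / θ' p a ≤ B * θ a)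
    (E : Finset (Ranking n)) {x : ℝ} (hx : (∑ σ ∈ E, A.outputProb θ σ).toReal = x)
    {y : ι → ℝ} (hy0 : ∀ p, 0 ≤ y p)
    (hy : ∀ p ∈ P, ∑ σ ∈ E, A.outputProb (θ' p) σ ≤ ENNReal.ofReal (y p))
    {c₀ c₁ : ℝ} (hc₀ : 0 < c₀) (hc : c₀ ≤ c₁) :
    P.card * (x * Real.log c₁ + (1 - x) * Real.log c₀ + 1 - c₀) - (c₁ - c₀) * ∑ p ∈ P, y p ≤
      B * m * (A.expectedRounds θ).toReal := by
  have hE : ∑ σ ∈ E, A.outputProb θ σ ≠ ⊤ := by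
    refine ne_top_of_le_ne_top ENNReal.one_ne_top ?_
    rw [← h, haltProb]
    exact Finset.sum_le_sum_of_subset (Finset.subset_univ _)
  have h1 := A.tendsto_earlyProb E hE
  rw [hx] at h1
  have h2 := (((((h1.mul_const (Real.log c₁)).add
    ((h1.const_sub 1).mul_const (Real.log c₀))).add_const 1).sub_const c₀).const_mul
      (P.card : ℝ)).sub_const ((c₁ - c₀) * ∑ p ∈ P, y p)
  refine le_of_tendsto' h2 fun D => ?_
  have h3 : ∀ p ∈ P, A.earlyProb θ E D * Real.log c₁ + (1 - A.earlyProb θ E D) * Real.log c₀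
      + 1 - c₀ - (c₁ - c₀) * y p ≤
      ∑ d ∈ Finset.range D, A.runSum θ d (fun h => ∑ S, (A.next h (Sum.inl S)).toReal *
        feedbackKL m θ (θ' p) S.1) := by
    intro p hp
    have h4 := A.change_of_measure hθ (hθ' p) hmk E D hc₀ (hc₀.trans_le hc)
    have h5 := mul_le_mul_of_nonneg_left (A.earlyProb_le E (hy0 p) (hy p hp) D) (sub_nonneg.2 hc)
    linarith
  have h6 := Finset.sum_le_sum h3
  rw [Finset.sum_sub_distrib, Finset.sum_const, nsmul_eq_mul, ← Finset.mul_sum] at h6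
  refine h6.trans ?_
  rw [Finset.sum_comm]
  calc _ ≤ ∑ d ∈ Finset.range D, A.runSum θ (d + 1) (fun _ => 1) * (B * m) := by
        refine Finset.sum_le_sum fun d _ => ?_
        rw [← runSum_finset_sum, A.runSum_succ hθ, ← runSum_mul_const]
        refine A.runSum_mono θ fun h => ?_
        rw [Finset.sum_comm, Finset.sum_mul]
        refine Finset.sum_le_sum fun S _ => ?_
        simp_rw [mul_one]
        rw [← Finset.mul_sum, sum_feedbackProb hθ m _ (by rw [S.2]; exact hmk), mul_one]
        exact mul_le_mul_of_nonneg_left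
          (sum_feedbackKL_le P hθ hθ' hB m _ (by rw [S.2]; exact hmk)) ENNReal.toReal_nonneg
    _ ≤ B * m * (A.expectedRounds θ).toReal := by
        rw [← Finset.sum_mul, mul_comm]
        exact mul_le_mul_of_nonneg_left (A.sum_runSum_one_le hθ hmk h ht D) (by positivity)

end Algorithm

end PLRank

namespace PLRank

/-! ### Choice of the weights -/

section Rate

lemma sub_sq_le_log_one_add {t : ℝ} (ht : 0 ≤ t) : t - t ^ 2 ≤ Real.log (1 + t) := by
  refine le_trans ?_ (Real.one_sub_inv_le_log_of_pos (by linarith))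
  have h : 1 - (1 + t)⁻¹ - (t - t ^ 2) = t ^ 3 / (1 + t) := by
    field_simp
    ring
  have : 0 ≤ t ^ 3 / (1 + t) := by positivity
  linarith

lemma neg_sub_sq_le_log_one_sub {t : ℝ} (ht' : t ≤ 1 / 2) :
    -t - 2 * t ^ 2 ≤ Real.log (1 - t) := by
  refine le_trans ?_ (Real.one_sub_inv_le_log_of_pos (by linarith))
  have h1 : 0 < 1 - t := by linarith
  have h : 1 - (1 - t)⁻¹ - (-t - 2 * t ^ 2) = t ^ 2 * (1 - 2 * t) / (1 - t) := by
    field_simp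
    ring
  have : 0 ≤ t ^ 2 * (1 - 2 * t) / (1 - t) :=
    div_nonneg (mul_nonneg (sq_nonneg _) (by linarith)) h1.le
  linarith

/-- Weights `c₁ = N / (2 * δ)` and `c₀ = 1 / 2`: the penalty `c₁ * Y` is at most `N / 2`, which the
constant `1 - c₀` absorbs. -/
lemma rate_of_small_error {δ₀ δ N x Y : ℝ} (hδ₀ : δ₀ < 1) (hδ : 0 < δ) (hδδ₀ : δ ≤ δ₀)
    (hN : 2 ≤ N) (hx : 1 - δ ≤ x) (hY0 : 0 ≤ Y) (hY : Y ≤ δ) :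
    N * ((1 - δ₀) * Real.log (N / δ) - Real.log 2) ≤
      N * (x * Real.log (N / (2 * δ)) + (1 - x) * Real.log (1 / 2) + 1 - 1 / 2) -
        (N / (2 * δ) - 1 / 2) * Y := by
  have hN0 : 0 < N := by linarith
  have h1 : Real.log (N / (2 * δ)) = Real.log (N / δ) - Real.log 2 := by
    rw [← Real.log_div (by positivity) (by norm_num)]
    congr 1
    field_simp
  have h2 : Real.log (1 / 2) = -Real.log 2 := by rw [one_div, Real.log_inv]
  have h3 : 0 ≤ Real.log (N / δ) := Real.log_nonneg (by rw [le_div_iff₀ hδ]; linarith)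
  have h4 : (N / (2 * δ)) * Y ≤ N * (1 / 2) := by
    calc _ ≤ N / (2 * δ) * δ := mul_le_mul_of_nonneg_left hY (by positivity)
      _ = N * (1 / 2) := by field_simp
  have h5 : (1 - δ₀) * Real.log (N / δ) ≤ x * Real.log (N / δ) :=
    mul_le_mul_of_nonneg_right (by linarith) h3
  have h6 := mul_le_mul_of_nonneg_left h5 hN0.le
  rw [h1, h2]
  linarith

/-- Weights `1 ± g / 2`: the first-order gain is `g` times the gap, at least `g ^ 2`, and the
second-order loss is at most `g ^ 2 / 2`. -/
lemma rate_of_gap {N x Y g : ℝ} (hN : 0 < N) (hx : x ≤ 1) (hx0 : 0 ≤ x) (hg : 0 < g) (hg1 : g ≤ 1)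
    (hgap : N * g ≤ N * x - Y) :
    N * (g ^ 2 / 2) ≤
      N * (x * Real.log (1 + g / 2) + (1 - x) * Real.log (1 - g / 2) + 1 - (1 - g / 2)) -
        ((1 + g / 2) - (1 - g / 2)) * Y := by
  have h1 := mul_le_mul_of_nonneg_left (sub_sq_le_log_one_add (t := g / 2) (by linarith)) hx0
  have h2 := mul_le_mul_of_nonneg_left (neg_sub_sq_le_log_one_sub (t := g / 2) (by linarith)) (sub_nonneg.2 hx)
  have h3 : g * x - g ^ 2 / 2 ≤
      x * Real.log (1 + g / 2) + (1 - x) * Real.log (1 - g / 2) + 1 - (1 - g / 2) := by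
    nlinarith [mul_nonneg hx0 (sq_nonneg g)]
  have h4 := mul_le_mul_of_nonneg_left h3 hN.le
  have h5 := mul_le_mul_of_nonneg_left hgap hg.le
  linarith

lemma exists_rate (δ₀ : ℝ) (h0 : 0 < δ₀) (h1 : δ₀ < 1) :
    ∃ c : ℝ, 0 < c ∧ ∀ (n : ℕ) (N : ℝ), 3 ≤ n → 1 < (n : ℝ) * (1 - δ₀) → (n : ℝ) - 1 ≤ N →
      ∀ δ x Y : ℝ, 0 < δ → δ ≤ δ₀ → 1 - δ ≤ x → x ≤ 1 → 0 ≤ Y → Y ≤ δ →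
        0 < Real.log (n / (4 * δ)) → ∃ c₀ c₁ : ℝ, 0 < c₀ ∧ c₀ ≤ c₁ ∧
          N * (c * Real.log (n / (4 * δ))) ≤
            N * (x * Real.log c₁ + (1 - x) * Real.log c₀ + 1 - c₀) - (c₁ - c₀) * Y := by
  set a := 1 - δ₀ with ha
  have ha0 : 0 < a := by linarith
  -- `M` is the least value of `n - 1` allowed by `n > 1 / (1 - δ₀)`, apart from `n ≥ 3`. So `g`
  -- bounds the gap `x - Y / N` below by a positive number depending on `δ₀` only.
  set M := ⌊1 / a⌋₊ with hM
  have hM1 : 1 ≤ M := by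
    rw [hM, Nat.one_le_floor_iff, le_div_iff₀ ha0]
    linarith
  have hM1' : (1 : ℝ) ≤ M := by exact_mod_cast hM1
  have hMlt : 1 / a < M + 1 := Nat.lt_floor_add_one _
  rw [div_lt_iff₀ ha0] at hMlt
  set g := a - δ₀ / M with hg
  have hg0 : 0 < g := by
    rw [hg, sub_pos, div_lt_iff₀ (by linarith)]
    linarith
  have hg1 : g ≤ 1 := by
    have : 0 < δ₀ / M := by positivity
    linarith
  have hlog2 : 0 < Real.log 2 := Real.log_pos (by norm_num)
  refine ⟨min (a / 2) (g ^ 2 / 2 * (a / (2 * Real.log 2))), by positivity, ?_⟩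
  intro n N hn hna hnN δ x Y hδ hδδ₀ hx hx1 hY0 hY hL
  have hn' : (3 : ℝ) ≤ n := by exact_mod_cast hn
  have hN2 : 2 ≤ N := by linarith
  set L := Real.log (n / (4 * δ)) with hLdef
  set ℓ := Real.log (N / δ) with hℓ
  have hLℓ : L ≤ ℓ := by
    refine Real.log_le_log (by positivity) ?_
    rw [div_le_div_iff₀ (by positivity) hδ]
    nlinarith
  -- If `ℓ` is large, `log 2` costs at most half of `a * ℓ`; otherwise `L` is bounded and a constant
  -- gain suffices.
  by_cases hcase : 2 * Real.log 2 ≤ a * ℓ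
  · refine ⟨1 / 2, N / (2 * δ), by norm_num, ?_, ?_⟩
    · rw [le_div_iff₀ (by positivity)]
      linarith
    · refine le_trans ?_ (rate_of_small_error h1 hδ hδδ₀ hN2 hx hY0 hY)
      refine mul_le_mul_of_nonneg_left ?_ (by linarith)
      calc _ ≤ a / 2 * ℓ := mul_le_mul (min_le_left _ _) hLℓ hL.le (by positivity)
        _ ≤ a * ℓ - Real.log 2 := by linarith
  · refine ⟨1 - g / 2, 1 + g / 2, by linarith, by linarith, ?_⟩
    have hMn : M < n := by
      rw [hM, Nat.floor_lt (by positivity), div_lt_iff₀ ha0]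
      exact hna
    have hMN : (M : ℝ) ≤ N := by
      have : ((M + 1 : ℕ) : ℝ) ≤ n := by exact_mod_cast hMn
      push_cast at this
      linarith
    refine le_trans ?_ (rate_of_gap (by linarith) hx1 (by linarith) hg0 hg1 ?_)
    · refine mul_le_mul_of_nonneg_left ?_ (by linarith)
      calc _ ≤ g ^ 2 / 2 * (a / (2 * Real.log 2)) * (2 * Real.log 2 / a) := by
            refine mul_le_mul (min_le_right _ _) ?_ hL.le (by positivity)
            rw [le_div_iff₀ ha0]
            push Not at hcase
            nlinarith
        _ = g ^ 2 / 2 := by field_simp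
    · have h2 : δ₀ ≤ N * (δ₀ / M) := by
        rw [mul_div_assoc', le_div_iff₀ (by linarith)]
        nlinarith
      have h3 : N * a ≤ N * x := mul_le_mul_of_nonneg_left (by linarith) (by linarith)
      rw [hg, mul_sub]
      linarith

end Rate

/-! ### The two-group instance and its exchanges -/

section HardInstance

variable {n : ℕ}

/-- Two well separated groups of scores, the first `q` items being the better ones. -/
noncomputable def twoGroups (n q : ℕ) (ε : ℝ) (l : Fin n) : ℝ :=
  if (l : ℕ) < q then 1 - ε * (l / (2 * n)) else 1 - 3 / 2 * ε - ε * (l / (2 * n))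

lemma offset_bounds (l : Fin n) : 0 ≤ (l : ℝ) / (2 * n) ∧ (l : ℝ) / (2 * n) < 1 / 2 := by
  have hl : (l : ℝ) < n := by exact_mod_cast l.2
  have hn : (0 : ℝ) < n := lt_of_le_of_lt (Nat.cast_nonneg _) hl
  refine ⟨by positivity, ?_⟩
  rw [div_lt_iff₀ (by positivity)]
  linarith

lemma twoGroups_le_one {q : ℕ} {ε : ℝ} (hε : 0 < ε) (l : Fin n) : twoGroups n q ε l ≤ 1 := by
  obtain ⟨h1, h2⟩ := offset_bounds l
  unfold twoGroups
  split_ifs <;> nlinarith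

lemma le_twoGroups {q : ℕ} {ε : ℝ} (hε : 0 < ε) (l : Fin n) : 1 - 2 * ε ≤ twoGroups n q ε l := by
  obtain ⟨h1, h2⟩ := offset_bounds l
  unfold twoGroups
  split_ifs <;> nlinarith

lemma twoGroups_gap {q : ℕ} {ε : ℝ} (hε : 0 < ε) {i j : Fin n} (hi : (i : ℕ) < q)
    (hj : ¬ (j : ℕ) < q) : twoGroups n q ε j + ε ≤ twoGroups n q ε i := by
  obtain ⟨h1, h2⟩ := offset_bounds i
  obtain ⟨h3, h4⟩ := offset_bounds j
  rw [twoGroups, twoGroups, if_pos hi, if_neg hj]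
  nlinarith

lemma twoGroups_injective {q : ℕ} {ε : ℝ} (hε : 0 < ε) :
    Function.Injective (twoGroups n q ε) := by
  intro i j h
  have hn : (0 : ℝ) < n := by exact_mod_cast i.pos
  have key : ∀ {s : ℝ}, s - ε * ((i : ℝ) / (2 * n)) = s - ε * (j / (2 * n)) → i = j := by
    intro s hs
    have h1 : ε * ((i : ℝ) / (2 * n)) = ε * (j / (2 * n)) := by linarith
    have h2 := mul_left_cancel₀ hε.ne' h1
    rw [div_left_inj' (by positivity)] at h2
    exact Fin.ext (by exact_mod_cast h2)
  by_cases hi : (i : ℕ) < q <;> by_cases hj : (j : ℕ) < q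
  · simp only [twoGroups, if_pos hi, if_pos hj] at h
    exact key h
  · linarith [twoGroups_gap hε hi hj]
  · linarith [twoGroups_gap hε hj hi]
  · simp only [twoGroups, if_neg hi, if_neg hj] at h
    exact key h

lemma isInstance_twoGroups {q : ℕ} {ε : ℝ} (hn : 0 < n) (hq : 0 < q) (hε : 0 < ε)
    (hε8 : ε ≤ 1 / 8) : IsInstance (twoGroups n q ε) where
  pos i := by linarith [le_twoGroups (q := q) hε i]
  le_one := twoGroups_le_one hε
  exists_eq_one := ⟨⟨0, hn⟩, by simp [twoGroups, hq]⟩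
  injective := twoGroups_injective hε

/-- Pairs of an item among the first `q` ones and another item. -/
def crossPairs (n q : ℕ) : Finset (Fin n × Fin n) :=
  (Finset.univ.filter fun i : Fin n => (i : ℕ) < q) ×ˢ
    (Finset.univ.filter fun j : Fin n => ¬ (j : ℕ) < q)

lemma mem_crossPairs {q : ℕ} {p : Fin n × Fin n} :
    p ∈ crossPairs n q ↔ (p.1 : ℕ) < q ∧ ¬ (p.2 : ℕ) < q := by
  simp [crossPairs]

lemma card_low {q : ℕ} (hq : q ≤ n) :
    (Finset.univ.filter fun i : Fin n => (i : ℕ) < q).card = q := by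
  rw [Fin.card_filter_val_lt, min_eq_right hq]

lemma card_high {q : ℕ} (hq : q ≤ n) :
    (Finset.univ.filter fun i : Fin n => ¬ (i : ℕ) < q).card = n - q := by
  have := Finset.card_filter_add_card_filter_not (s := Finset.univ) (fun i : Fin n => (i : ℕ) < q)
  rw [card_low hq, Finset.card_univ, Fintype.card_fin] at this
  omega

lemma card_crossPairs {q : ℕ} (hq : q ≤ n) : (crossPairs n q).card = q * (n - q) := by
  rw [crossPairs, Finset.card_product, card_low hq, card_high hq]

lemma card_crossPairs_filter_le (q : ℕ) (a : Fin n) :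
    ((crossPairs n q).filter fun p => p.1 = a ∨ p.2 = a).card ≤ n := by
  conv_rhs => rw [← Fintype.card_fin n, ← Finset.card_univ]
  by_cases ha : (a : ℕ) < q
  · refine Finset.card_le_card_of_injOn Prod.snd (fun _ _ => Finset.mem_coe.2 (Finset.mem_univ _)) ?_
    rintro ⟨i, j⟩ h ⟨i', j'⟩ h' hjj
    simp only [Finset.coe_filter, mem_crossPairs, Set.mem_ofPred_eq] at h h' hjj
    grind
  · refine Finset.card_le_card_of_injOn Prod.fst (fun _ _ => Finset.mem_coe.2 (Finset.mem_univ _)) ?_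
    rintro ⟨i, j⟩ h ⟨i', j'⟩ h' hjj
    simp only [Finset.coe_filter, mem_crossPairs, Set.mem_ofPred_eq] at h h' hjj
    grind

lemma sum_swap_chiSq_le {q : ℕ} {ε : ℝ} (hε : 0 < ε) (hε8 : ε ≤ 1 / 8) (a : Fin n) :
    ∑ p ∈ crossPairs n q, (twoGroups n q ε a - (twoGroups n q ε ∘ Equiv.swap p.1 p.2) a) ^ 2 /
      (twoGroups n q ε ∘ Equiv.swap p.1 p.2) a ≤ 8 * n * ε ^ 2 * twoGroups n q ε a := by
  have h1 : ∀ p ∈ crossPairs n q,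
      (twoGroups n q ε a - (twoGroups n q ε ∘ Equiv.swap p.1 p.2) a) ^ 2 /
      (twoGroups n q ε ∘ Equiv.swap p.1 p.2) a ≤ if p.1 = a ∨ p.2 = a then 6 * ε ^ 2 else 0 := by
    intro p _
    split_ifs with hp
    · rw [Function.comp_apply]
      set b := Equiv.swap p.1 p.2 a
      have ha1 := twoGroups_le_one (q := q) hε a
      have ha2 := le_twoGroups (q := q) hε a
      have hb1 := twoGroups_le_one (q := q) hε b
      have hb2 := le_twoGroups (q := q) hε b
      -- All scores are at least `3 / 4`, so the quotient is at most `4 * ε ^ 2 / (3 / 4) ≤ 6 * ε ^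
      -- 2`.
      rw [div_le_iff₀ (by linarith)]
      have h2 : (twoGroups n q ε a - twoGroups n q ε b) ^ 2 ≤ (2 * ε) ^ 2 :=
        sq_le_sq' (by linarith) (by linarith)
      nlinarith [sq_nonneg ε]
    · push Not at hp
      rw [Function.comp_apply, Equiv.swap_apply_of_ne_of_ne hp.1.symm hp.2.symm]
      simp
  refine (Finset.sum_le_sum h1).trans ?_
  rw [← Finset.sum_filter, Finset.sum_const, nsmul_eq_mul]
  have h3 : (((crossPairs n q).filter fun p => p.1 = a ∨ p.2 = a).card : ℝ) ≤ n := by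
    exact_mod_cast card_crossPairs_filter_le q a
  have ha2 := le_twoGroups (q := q) hε a
  calc _ ≤ (n : ℝ) * (6 * ε ^ 2) := mul_le_mul_of_nonneg_right h3 (by positivity)
    _ = 8 * n * ε ^ 2 * (3 / 4) := by ring
    _ ≤ _ := mul_le_mul_of_nonneg_left (by linarith) (by positivity)

/-- Rankings that put the first `q` items on the first `q` positions. -/
def separating (n q : ℕ) : Finset (Ranking n) :=
  Finset.univ.filter fun σ => ∀ l, ((σ l : ℕ) < q ↔ (l : ℕ) < q)

lemma mem_separating {q : ℕ} {σ : Ranking n} :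
    σ ∈ separating n q ↔ ∀ l, ((σ l : ℕ) < q ↔ (l : ℕ) < q) := by
  simp [separating]

/-- If a better item is placed at `q` or later, no worse item may precede it; then the worse items
fill all positions from `q` on, leaving no room for it. -/
lemma IsEpsBestRanking.mem_separating {q : ℕ} {ε : ℝ} (hε : 0 < ε) {σ : Ranking n}
    (h : IsEpsBestRanking (twoGroups n q ε) ε σ) : σ ∈ separating n q := by
  have h1 : ∀ l : Fin n, (l : ℕ) < q → (σ l : ℕ) < q := by
    intro i hi
    by_contra hσi
    have h2 : ∀ j : Fin n, ¬ (j : ℕ) < q → ¬ (σ j : ℕ) < q := by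
      intro j hj hσj
      exact h ⟨i, j, Fin.lt_def.2 (by omega), twoGroups_gap hε hi hj⟩
    have h3 := Equiv.Perm.perm_symm_on_of_perm_on_finite (f := σ)
      (p := fun j : Fin n => ¬ (j : ℕ) < q) h2 hσi
    exact h3 (by simpa using hi)
  refine PLRank.mem_separating.2 fun l => ⟨fun hl => ?_, h1 l⟩
  have h3 := Equiv.Perm.perm_symm_on_of_perm_on_finite (f := σ)
    (p := fun j : Fin n => (j : ℕ) < q) h1 hl
  simpa using h3

/-- Rankings that separate the two groups after the items of `p` have been exchanged. -/
def swapSeparating (n q : ℕ) (p : Fin n × Fin n) : Finset (Ranking n) :=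
  Finset.univ.filter fun τ => (Equiv.swap p.1 p.2).trans τ ∈ separating n q

lemma mem_swapSeparating {q : ℕ} {p : Fin n × Fin n} {τ : Ranking n} :
    τ ∈ swapSeparating n q p ↔
      ∀ l, ((τ l : ℕ) < q ↔ (Equiv.swap p.1 p.2 l : ℕ) < q) := by
  simp only [swapSeparating, Finset.mem_filter, Finset.mem_univ, true_and, mem_separating,
    Equiv.trans_apply]
  refine ⟨fun h l => ?_, fun h l => ?_⟩
  · simpa using h (Equiv.swap p.1 p.2 l)
  · simpa using h (Equiv.swap p.1 p.2 l)

lemma disjoint_separating_swapSeparating {q : ℕ} {p : Fin n × Fin n} (hp : p ∈ crossPairs n q) :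
    Disjoint (separating n q) (swapSeparating n q p) := by
  rw [Finset.disjoint_left]
  intro τ h1 h2
  obtain ⟨hi, hj⟩ := mem_crossPairs.1 hp
  have h3 := mem_separating.1 h1 p.1
  have h4 := mem_swapSeparating.1 h2 p.1
  rw [Equiv.swap_apply_left] at h4
  tauto

/-- The set of items on the first `q` positions determines which pair was exchanged. -/
lemma pairwiseDisjoint_swapSeparating (q : ℕ) :
    (crossPairs n q : Set (Fin n × Fin n)).PairwiseDisjoint (swapSeparating n q) := by
  intro p hp p' hp' hne
  rw [Function.onFun, Finset.disjoint_left]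
  intro τ h1 h2
  obtain ⟨hi, hj⟩ := mem_crossPairs.1 hp
  obtain ⟨hi', hj'⟩ := mem_crossPairs.1 hp'
  rw [mem_swapSeparating] at h1 h2
  refine hne (Prod.ext ?_ ?_)
  · by_contra hne1
    have h3 := h1 p.1
    have h4 := h2 p.1
    rw [Equiv.swap_apply_left] at h3
    rw [Equiv.swap_apply_of_ne_of_ne hne1 (fun h => hj' (by rw [← h]; exact hi))] at h4
    tauto
  · by_contra hne1
    have h3 := h1 p.2
    have h4 := h2 p.2
    rw [Equiv.swap_apply_right] at h3
    rw [Equiv.swap_apply_of_ne_of_ne (fun h => hj (by rw [h]; exact hi')) hne1] at h4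
    tauto

lemma sum_outputProb_swap {k m : ℕ} {A : Algorithm n k m} (hA : IsSymmetric A) {θ : Fin n → ℝ}
    (hθ : IsInstance θ) (q : ℕ) (p : Fin n × Fin n) :
    ∑ σ ∈ separating n q, A.outputProb (θ ∘ Equiv.swap p.1 p.2) σ =
      ∑ τ ∈ swapSeparating n q p, A.outputProb θ τ := by
  have hinv : ∀ τ : Ranking n, (Equiv.swap p.1 p.2).trans ((Equiv.swap p.1 p.2).trans τ) = τ := by
    intro τ
    ext l
    simp
  symm
  refine Finset.sum_nbij' (fun τ => (Equiv.swap p.1 p.2).trans τ)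
    (fun τ => (Equiv.swap p.1 p.2).trans τ) ?_ ?_ (fun τ _ => hinv τ) (fun τ _ => hinv τ)
    (fun τ _ => hA θ hθ _ τ)
  · intro τ hτ
    exact (Finset.mem_filter.1 hτ).2
  · intro τ hτ
    rw [swapSeparating, Finset.mem_filter, hinv]
    exact ⟨Finset.mem_univ _, hτ⟩

lemma sum_separating_add_sum_swap_le {k m : ℕ} {A : Algorithm n k m} (θ : Fin n → ℝ) (q : ℕ) :
    ∑ σ ∈ separating n q, A.outputProb θ σ +
      ∑ p ∈ crossPairs n q, ∑ τ ∈ swapSeparating n q p, A.outputProb θ τ ≤ A.haltProb θ := by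
  classical
  rw [← Finset.sum_biUnion (pairwiseDisjoint_swapSeparating q), ← Finset.sum_union]
  · exact Finset.sum_le_sum_of_subset (Finset.subset_univ _)
  · rw [Finset.disjoint_biUnion_right]
    exact fun p hp => disjoint_separating_swapSeparating hp

end HardInstance

end PLRank

/-! ### Assembly of the lower bound -/

theorem theorem4 (δ₀ : ℝ) (hδ₀_pos : 0 < δ₀) (hδ₀_lt : δ₀ < 1) :
    ∃ c : ℝ, 0 < c ∧
      ∀ (n k m : ℕ), 3 ≤ n → 1 < (n : ℝ) * (1 - δ₀) → 2 ≤ m → m ≤ k → k ≤ n →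
      ∀ (ε δ : ℝ), 0 < ε → ε ≤ 1 / 8 → 0 < δ → δ ≤ δ₀ →
      ∀ A : PLRank.Algorithm n k m, PLRank.IsSymmetric A → PLRank.IsPACRank A ε δ →
        ∃ θ : Fin n → ℝ, PLRank.IsInstance θ ∧
          ENNReal.ofReal
              (c * ((n : ℝ) / ((m : ℝ) * ε ^ 2)) * Real.log ((n : ℝ) / (4 * δ))) ≤
            A.expectedRounds θ := by
  classical
  obtain ⟨c, hc, hrate⟩ := PLRank.exists_rate δ₀ hδ₀_pos hδ₀_lt
  -- `36 = 8 / (2 / 9)`, from the divergence bound `8 * n * ε ^ 2` and the `2 / 9 * n ^ 2` cross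
  -- pairs.
  refine ⟨c / 36, by positivity, ?_⟩
  intro n k m hn hnδ hm hmk hkn ε δ hε hε8 hδ hδδ₀ A hsymm hpac
  obtain ⟨q, hq⟩ : ∃ q, q = n / 2 := ⟨_, rfl⟩
  have hinst := PLRank.isInstance_twoGroups (n := n) (q := q) (by omega) (by omega) hε hε8
  set θ := PLRank.twoGroups n q ε with hθdef
  refine ⟨θ, hinst, ?_⟩
  by_cases ht : A.expectedRounds θ = ⊤
  · rw [ht]
    exact le_top
  obtain ⟨hhalt, hout⟩ := hpac θ hinst
  have hmR : (2 : ℝ) ≤ m := by exact_mod_cast hm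
  have hnR : (3 : ℝ) ≤ n := by exact_mod_cast hn
  rcases le_or_gt (Real.log ((n : ℝ) / (4 * δ))) 0 with hL | hL
  · rw [ENNReal.ofReal_of_nonpos]
    · exact zero_le
    · exact mul_nonpos_of_nonneg_of_nonpos (by positivity) hL
  have hsum := PLRank.sum_separating_add_sum_swap_le (A := A) θ q
  rw [hhalt] at hsum
  have hfin1 := ne_top_of_le_ne_top ENNReal.one_ne_top (le_self_add.trans hsum)
  have hfin2 := ne_top_of_le_ne_top ENNReal.one_ne_top (le_add_self.trans hsum)
  have hfin3 := ENNReal.sum_ne_top.1 hfin2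
  set x := (∑ σ ∈ PLRank.separating n q, A.outputProb θ σ).toReal with hx
  set y : Fin n × Fin n → ℝ :=
    fun p => (∑ τ ∈ PLRank.swapSeparating n q p, A.outputProb θ τ).toReal with hy
  have hxy : x + ∑ p ∈ PLRank.crossPairs n q, y p ≤ 1 := by
    rw [hx, hy, ← ENNReal.toReal_sum hfin3, ← ENNReal.toReal_add hfin1 hfin2]
    exact ENNReal.toReal_le_of_le_ofReal zero_le_one (by simpa using hsum)
  have hxδ : 1 - δ ≤ x := by
    rw [hx, ← ENNReal.ofReal_le_iff_le_toReal hfin1]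
    refine hout.trans (Finset.sum_le_sum_of_subset fun σ hσ => ?_)
    exact PLRank.IsEpsBestRanking.mem_separating hε (Finset.mem_filter.1 hσ).2
  have hy0 : ∀ p, 0 ≤ y p := fun p => ENNReal.toReal_nonneg
  have hY0 : 0 ≤ ∑ p ∈ PLRank.crossPairs n q, y p := Finset.sum_nonneg fun p _ => hy0 p
  -- The factor `2 / 9` is attained at `n = 3`.
  have hcard : 2 / 9 * (n : ℝ) ^ 2 ≤ (PLRank.crossPairs n q).card ∧
      (n : ℝ) - 1 ≤ (PLRank.crossPairs n q).card := by
    rw [PLRank.card_crossPairs (by omega)]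
    obtain ⟨s, hs⟩ : ∃ s, s = n - q := ⟨_, rfl⟩
    have hnqs : n = q + s := by omega
    have hcase : s = q ∨ s = q + 1 := by omega
    have hq1 : (1 : ℝ) ≤ q := by exact_mod_cast (by omega : 1 ≤ q)
    rw [← hs, hnqs]
    push_cast
    rcases hcase with h | h <;> rw [h] <;> push_cast <;> constructor <;> nlinarith
  obtain ⟨c₀, c₁, hc₀, hc₁, hbound⟩ := hrate n _ hn hnδ hcard.2 δ x
    (∑ p ∈ PLRank.crossPairs n q, y p) hδ hδδ₀ hxδ (by linarith) hY0 (by linarith) hL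
  have hmain := A.expectedRounds_lower_bound hinst.pos hmk hhalt ht (PLRank.crossPairs n q)
    (θ' := fun p => θ ∘ Equiv.swap p.1 p.2) (fun p i => hinst.pos _)
    (B := 8 * n * ε ^ 2) (by positivity) (PLRank.sum_swap_chiSq_le hε hε8)
    (PLRank.separating n q) hx.symm hy0
    (fun p hp => by
      rw [PLRank.sum_outputProb_swap hsymm hinst, hy, ENNReal.ofReal_toReal (hfin3 p hp)])
    hc₀ hc₁
  rw [ENNReal.ofReal_le_iff_le_toReal ht]
  have h1 := hbound.trans hmain
  have h2 : 2 / 9 * (n : ℝ) ^ 2 * (c * Real.log (n / (4 * δ))) ≤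
      8 * n * ε ^ 2 * m * (A.expectedRounds θ).toReal :=
    (mul_le_mul_of_nonneg_right hcard.1 (by positivity)).trans h1
  rw [show c / 36 * ((n : ℝ) / (m * ε ^ 2)) * Real.log (n / (4 * δ)) =
    2 / 9 * (n : ℝ) ^ 2 * (c * Real.log (n / (4 * δ))) / (8 * n * ε ^ 2 * m) by
      field_simp
      ring, div_le_iff₀ (by positivity)]
  linarith
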